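/- Let $I\subseteq\mathbb R$ be an open interval and use coordinates $(t,x,y,z)$ with $t\in I$, $x,y,z\in\mathbb R$; all functions are smooth. For a metric $g_{\mu\nu}$ and a potential $V(t,x,y,z)$ consider the Klein-Gordon equation $\Delta u-Vu=0$, $\Delta u=|g|^{-1/2}\partial_\mu(|g|^{1/2}g^{\mu\nu}\partial_\nu u)$. A vector field $X=\xi^\mu(x,u)\partial_\mu+\eta(x,u)\partial_u$ is a Lie symmetry if its second prolongation annihilates $\Delta u-Vu$ whenever $\Delta u-Vu=0$. (A) Let $ds^2=-N^2dt^2+A^2dx^2+B^2dy^2+C^2e^{-2x}dz^2$ (Bianchi III), with $N,A,B,C$ nowhere vanishing functions of $t\in I$. Then $\xi^1=\partial_x+z\partial_z$, $\xi^2=\partial_y$, $\xi^3=\partial_z$ are Killing vectors, and: (i) $\xi^1$ is a Lie symmetry if and only if $V=U(t,y,ze^{-x})$ for some $U$; (ii) $\xi^2$ is a Lie symmetry if and only if $V=U(t,x,z)$ for some $U$; (iii) $\xi^3$ is a Lie symmetry if and only if $V=U(t,x,y)$ for some $U$; (iv) $\alpha\xi^1+\beta\xi^2+\gamma\xi^3$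 is a Lie symmetry if and only if, for some $U$, $V=U\big(t,\,y-\tfrac{\beta}{\alpha}x,\,(z+\tfrac{\gamma}{\alpha})e^{-x}\big)$ when $\alpha\neq0$, respectively $V=U(t,x,\beta z-\gamma y)$ when $\alpha=0$ and $(\beta,\gamma)\ne(0,0)$. (B) Let $m\neq0$ and $\lambda$ be real, $A$ a nowhere vanishing function of $t\in I$, and $$ds^2=A^2(t)\left[e^{m\lambda t}(-dt^2+dx^2)+e^{m(\lambda-1)t}dy^2+e^{-2x}dz^2\right].$$ Then $X_3=\tfrac2m\partial_t+y\partial_y+\lambda z\partial_z$ is a conformal Killing vector, $\mathcal L_{X_3}g=2\psi g$ with $\psi=\tfrac2m\tfrac{A_{,t}}{A}+\lambda$, and: (v) $X_3-\big(\tfrac{2}{m}\tfrac{A_{,t}}{A}+\lambda\big)u\,\partial_u$ is a Lie symmetry if and only if, for some $U$, $$V=\frac{e^{-m\lambda t}}{A^2}\,U\!\left(x,\;ye^{-\frac m2t},\;ze^{-\frac{m\lambda}2t}\right)+e^{-m\lambda t}\,\frac{m(\lambda-1)A_{,t}+2A_{,tt}}{2A^3};$$ (vi) for real $\alpha,\beta,\gamma$,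 $X_3+\alpha\xi^1+\beta\xi^2+\gamma\xi^3-\big(\tfrac{2}{m}\tfrac{A_{,t}}{A}+\lambda\big)u\,\partial_u$ is a Lie symmetry if and only if, for some $U$, $$V=\frac{e^{-m\lambda t}}{A^2}\,U\!\left(x-\tfrac{\alpha m}{2}t,\;(y+\beta)e^{-\frac m2t},\;\zeta\right)+e^{-m\lambda t}\,\frac{m(\lambda-1)A_{,t}+2A_{,tt}}{2A^3},$$ where $\zeta=\big(z+\tfrac{\gamma}{\lambda+\alpha}\big)e^{-\frac{m(\lambda+\alpha)}2t}$ if $\lambda+\alpha\ne0$ and $\zeta=z-\tfrac{\gamma m}{2}t$ if $\lambda+\alpha=0$. -/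

import Mathlib

open scoped ContDiff

noncomputable section

namespace KGSym

/-- Coordinates `(x^0, …, x^{n-1})`. -/
abbrev Coord (n : ℕ) := Fin n → ℝ

/-- First-order jets `(x^μ, u, u_μ)`. -/
abbrev Jet1 (n : ℕ) := Coord n × ℝ × (Fin n → ℝ)

/-- Second-order jets `(x^μ, u, u_μ, u_{μν})`. The second-order part of an actual jet is a
symmetric matrix; this is imposed in `IsLieSymmetry`. -/
abbrev Jet2 (n : ℕ) := Coord n × ℝ × (Fin n → ℝ) × (Fin n → Fin n → ℝ)

/-- The `μ`-th coordinate vector. -/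
def basisVec {n : ℕ} (μ : Fin n) : Coord n := Pi.single μ 1

/-- The partial derivative `∂_μ f`. -/
def pd {n : ℕ} (μ : Fin n) (f : Coord n → ℝ) (x : Coord n) : ℝ :=
  fderiv ℝ f x (basisVec μ)

/-- Total derivative `D_μ f = f_{,μ} + u_μ f_{,u}` of a function `f (x, u)`. -/
def totalDeriv0 {n : ℕ} (μ : Fin n) (f : Coord n × ℝ → ℝ) (j : Jet1 n) : ℝ :=
  fderiv ℝ f (j.1, j.2.1) (basisVec μ, j.2.2 μ)

/-- Total derivative `D_μ F = F_{,μ} + u_μ F_{,u} + u_{μκ} ∂F/∂u_κ` of a function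
`F (x, u, u_κ)`. -/
def totalDeriv1 {n : ℕ} (μ : Fin n) (F : Jet1 n → ℝ) (j : Jet2 n) : ℝ :=
  fderiv ℝ F (j.1, j.2.1, j.2.2.1) (basisVec μ, j.2.2.1 μ, j.2.2.2 μ)

/-- Generator `X = ξ^μ(x,u) ∂_μ + η(x,u) ∂_u` of a one-parameter point transformation. -/
structure PointField (n : ℕ) where
  xi : Coord n × ℝ → Coord n
  eta : Coord n × ℝ → ℝ

/-- `η_μ = D_μ η - (D_μ ξ^ν) u_ν`. -/
def eta1 {n : ℕ} (X : PointField n) (μ : Fin n) (j : Jet1 n) : ℝ :=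
  totalDeriv0 μ X.eta j - ∑ ν, totalDeriv0 μ (fun p => X.xi p ν) j * j.2.2 ν

/-- `η_{μν} = D_ν η_μ - (D_ν ξ^κ) u_{μκ}`. -/
def eta2 {n : ℕ} (X : PointField n) (μ ν : Fin n) (j : Jet2 n) : ℝ :=
  totalDeriv1 ν (eta1 X μ) j -
    ∑ κ, totalDeriv0 ν (fun p => X.xi p κ) (j.1, j.2.1, j.2.2.1) * j.2.2.2 μ κ

/-- The second prolongation
`X^{[2]} = ξ^μ ∂_μ + η ∂_u + η_μ ∂/∂u_μ + η_{μν} ∂/∂u_{μν}`, as a vector at the jet `j`. -/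
def prolong2 {n : ℕ} (X : PointField n) (j : Jet2 n) : Jet2 n :=
  (X.xi (j.1, j.2.1), X.eta (j.1, j.2.1),
    fun μ => eta1 X μ (j.1, j.2.1, j.2.2.1), fun μ ν => eta2 X μ ν j)

/-- `X` is a Lie point symmetry, over the domain `D`, of the differential equation
`H (x, u, u_μ, u_{μν}) = 0`: `X` is smooth and `X^{[2]} H = 0` whenever `H = 0`. -/
def IsLieSymmetry {n : ℕ} (D : Set (Coord n)) (H : Jet2 n → ℝ) (X : PointField n) : Prop :=
  ContDiffOn ℝ ∞ X.xi (D ×ˢ Set.univ) ∧ ContDiffOn ℝ ∞ X.eta (D ×ˢ Set.univ) ∧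
    ∀ j : Jet2 n, j.1 ∈ D → (∀ μ ν, j.2.2.2 μ ν = j.2.2.2 ν μ) → H j = 0 →
      fderiv ℝ H j (prolong2 X j) = 0

/-- A metric tensor `g_{μν}(x)` in coordinates. -/
abbrev Metric (n : ℕ) := Coord n → Matrix (Fin n) (Fin n) ℝ

/-- The left-hand side of the Klein-Gordon equation `Δu - V u = 0` as a function on second-order
jets, where `Δu = |g|^{-1/2} ∂_μ (|g|^{1/2} g^{μν} u_{,ν})`. -/
def kleinGordon {n : ℕ} (g : Metric n) (V : Coord n → ℝ) (j : Jet2 n) : ℝ :=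
  (√|(g j.1).det|)⁻¹ *
      ∑ μ, totalDeriv1 μ
        (fun i : Jet1 n => √|(g i.1).det| * ∑ ν, (g i.1)⁻¹ μ ν * i.2.2 ν) j
    - V j.1 * j.2.1

/-- The Lie derivative `(L_ξ g)_{μν} = ξ^κ ∂_κ g_{μν} + g_{κν} ∂_μ ξ^κ + g_{μκ} ∂_ν ξ^κ`. -/
def lieMetric {n : ℕ} (g : Metric n) (ξ : Coord n → Coord n) (x : Coord n) (μ ν : Fin n) : ℝ :=
  ∑ κ, (ξ x κ * pd κ (fun y => g y μ ν) x + g x κ ν * pd μ (fun y => ξ y κ) x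
    + g x μ κ * pd ν (fun y => ξ y κ) x)

/-- `ξ` is a conformal Killing vector of `g` on `D` with conformal factor `ψ`:
`L_ξ g = 2 ψ g`. -/
def IsCKV {n : ℕ} (D : Set (Coord n)) (g : Metric n) (ξ : Coord n → Coord n)
    (ψ : Coord n → ℝ) : Prop :=
  ∀ x ∈ D, ∀ μ ν, lieMetric g ξ x μ ν = 2 * ψ x * g x μ ν

/-- `ξ` is a Killing vector of `g` on `D`: `L_ξ g = 0`. -/
def IsKV {n : ℕ} (D : Set (Coord n)) (g : Metric n) (ξ : Coord n → Coord n) : Prop :=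
  ∀ x ∈ D, ∀ μ ν, lieMetric g ξ x μ ν = 0

/-- The coordinate domain `t ∈ I`, `x, y, z ∈ ℝ`; coordinates are ordered `(t, x, y, z)`. -/
def slab (I : Set ℝ) : Set (Coord 4) := {p | p 0 ∈ I}

/-- The Bianchi III line element
`-N(t)² dt² + A(t)² dx² + B(t)² dy² + C(t)² e^{-2x} dz²`. -/
def bianchiIII (N A B C : ℝ → ℝ) : Metric 4 := fun p =>
  Matrix.diagonal ![-(N (p 0)) ^ 2, (A (p 0)) ^ 2, (B (p 0)) ^ 2,
    (C (p 0)) ^ 2 * Real.exp (-2 * p 1)]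

/-- The line element
`A(t)² [e^{mλt} (-dt² + dx²) + e^{m(λ-1)t} dy² + e^{-2x} dz²]`. -/
def conformalBianchiIII (A : ℝ → ℝ) (m l : ℝ) : Metric 4 := fun p =>
  (A (p 0)) ^ 2 • Matrix.diagonal ![-Real.exp (m * l * p 0), Real.exp (m * l * p 0),
    Real.exp (m * (l - 1) * p 0), Real.exp (-2 * p 1)]

theorem conformalBianchiIII_eq (A : ℝ → ℝ) (m l : ℝ) :
    conformalBianchiIII A m l =
      bianchiIII (fun t => A t * Real.exp (m * l * t / 2))
        (fun t => A t * Real.exp (m * l * t / 2))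
        (fun t => A t * Real.exp (m * (l - 1) * t / 2)) A := by
  have h : ∀ s : ℝ, Real.exp (s / 2) ^ 2 = Real.exp s := fun s => by
    rw [← Real.exp_nat_mul]; congr 1; push_cast; ring
  funext p
  simp only [conformalBianchiIII, bianchiIII, mul_pow, h, ← Matrix.diagonal_smul]
  congr 1
  funext i
  fin_cases i <;> simp

/-- `ξ¹ = ∂_x + z ∂_z`. -/
def xi1 : Coord 4 → Coord 4 := fun p => ![0, 1, 0, p 3]

/-- `ξ² = ∂_y`. -/
def xi2 : Coord 4 → Coord 4 := fun _ => ![0, 0, 1, 0]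

/-- `ξ³ = ∂_z`. -/
def xi3 : Coord 4 → Coord 4 := fun _ => ![0, 0, 0, 1]

/-- `α ξ¹ + β ξ² + γ ξ³`. -/
def xiComb (α β γ : ℝ) : Coord 4 → Coord 4 := fun p => α • xi1 p + β • xi2 p + γ • xi3 p

/-- `X₃ = (2/m) ∂_t + y ∂_y + λ z ∂_z`. -/
def X3 (m l : ℝ) : Coord 4 → Coord 4 := fun p => ![2 / m, 0, p 2, l * p 3]

/-- `ψ(t) = (2/m) A_{,t}/A + λ`. -/
def confFactor (A : ℝ → ℝ) (m l : ℝ) (t : ℝ) : ℝ := 2 / m * (deriv A t / A t) + l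

/-- A vector field on the spacetime, regarded as the point generator `ξ^μ(x) ∂_μ`. -/
def horizontal {n : ℕ} (ξ : Coord n → Coord n) : PointField n where
  xi := fun p => ξ p.1
  eta := fun _ => 0

/-- `X₃ + α ξ¹ + β ξ² + γ ξ³ - ((2/m) A_{,t}/A + λ) u ∂_u`. -/
def X3Field (A : ℝ → ℝ) (m l α β γ : ℝ) : PointField 4 where
  xi := fun p => X3 m l p.1 + xiComb α β γ p.1
  eta := fun p => -(confFactor A m l (p.1 0)) * p.2

/-- The explicit term `e^{-mλt} (m(λ-1) A_{,t} + 2 A_{,tt}) / (2 A³)` of the potentials. -/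
def explicitTerm (A : ℝ → ℝ) (m l : ℝ) (t : ℝ) : ℝ :=
  Real.exp (-(m * l * t)) * (m * (l - 1) * deriv A t + 2 * deriv (deriv A) t) / (2 * A t ^ 3)

end KGSym

end

noncomputable section

namespace KGSym

/-! In four dimensions, let `ξ` be a conformal Killing vector with factor `ψ`, extended by `-ψ u
∂_u`. The inverse metric has weight `-2` and `u` has weight `-1`, and the first-derivative terms
cancel. The second prolongation therefore sends `H = Δu - V u` to `-3 ψ H - u (ξ(V) + 2 ψ V + Δψ)`
(`prolong2_kleinGordon`). Since `u` can be nonzero on `H = 0`, symmetry is equivalent to the linear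
transport equation `ξ(V) + 2 ψ V = -Δψ` (`isLieSymmetry_affineField_iff`). Every generator in
question is affine in the coordinates with `ψ = ψ(t)`, so the single family `affineField` covers
both metrics.

For Killing vectors `ψ = 0`, and the equation says that `V` is constant along orbits. Writing the
orbits explicitly in terms of their invariants and one parameter turns this into `V = U(invariants)`
(`forall_fderiv_eq_zero_iff_exists`).

For `X₃` the factor `A² e^{mλt}` integrates the homogeneous part. Multiplied by it, `-Δψ` becomes
`(2/m) d/dt (A''/A + m(λ-1)A'/(2A))`, because `h'' + 2hh' = (h' + h²)' = (A''/A)'` for `h = A'/A`.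
This yields the explicit term as a particular solution (`explicitTerm_transport`). The rescaled
difference `A² e^{mλt} (V - explicitTerm)` is then constant along orbits. -/

/-- The generator `c ∂_t + α ∂_x + (p y + β) ∂_y + (q z + γ) ∂_z - ψ(t) u ∂_u`. -/
def affineField (c α p β q γ : ℝ) (ψ : ℝ → ℝ) : PointField 4 where
  xi := fun r => ![c, α, p * r.1 2 + β, q * r.1 3 + γ]
  eta := fun r => -(ψ (r.1 0)) * r.2

/-! ### The Klein-Gordon operator of a Bianchi III metric in coordinates. -/

theorem isOpen_slab {I : Set ℝ} (hI : IsOpen I) : IsOpen (slab I) :=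
  hI.preimage (continuous_apply 0)

theorem hasFDerivAt_comp_coord {n : ℕ} (i : Fin n) {φ : ℝ → ℝ} {φ' : ℝ} {p : Coord n}
    (h : HasDerivAt φ φ' (p i)) :
    HasFDerivAt (fun r : Coord n => φ (r i)) (φ' • ContinuousLinearMap.proj (R := ℝ) i) p :=
  h.comp_hasFDerivAt (f := fun r : Coord n => r i) p (hasFDerivAt_apply i p)

/-- The determinant is minus a perfect square. The absolute value remains because the scale factors
have no prescribed sign. -/
theorem bianchiIII_sqrt_det (N A B C : ℝ → ℝ) (p : Coord 4) :
    √|(bianchiIII N A B C p).det| =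
      |N (p 0) * A (p 0) * B (p 0) * C (p 0)| * Real.exp (-p 1) := by
  have h : (bianchiIII N A B C p).det =
      -(|N (p 0) * A (p 0) * B (p 0) * C (p 0)| * Real.exp (-p 1)) ^ 2 := by
    have h2 : Real.exp (-2 * p 1) = Real.exp (-p 1) ^ 2 := by
      rw [← Real.exp_nat_mul]; congr 1; push_cast; ring
    rw [mul_pow, sq_abs]
    simp only [bianchiIII, Matrix.det_diagonal, Fin.prod_univ_four, h2]
    simp
    ring
  rw [h, abs_neg, abs_sq, Real.sqrt_sq (by positivity)]

theorem bianchiIII_inv {N A B C : ℝ → ℝ} {p : Coord 4}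
    (h : N (p 0) ≠ 0 ∧ A (p 0) ≠ 0 ∧ B (p 0) ≠ 0 ∧ C (p 0) ≠ 0) :
    (bianchiIII N A B C p)⁻¹ = Matrix.diagonal ![-((N (p 0)) ^ 2)⁻¹, ((A (p 0)) ^ 2)⁻¹,
      ((B (p 0)) ^ 2)⁻¹, ((C (p 0)) ^ 2)⁻¹ * Real.exp (2 * p 1)] := by
  obtain ⟨h0, h1, h2, h3⟩ := h
  apply Matrix.inv_eq_right_inv
  have he : Real.exp (-2 * p 1) * Real.exp (2 * p 1) = 1 := by
    rw [← Real.exp_add]; simp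
  rw [bianchiIII, Matrix.diagonal_mul_diagonal, ← Matrix.diagonal_one]
  congr 1
  funext i
  fin_cases i
  · simp [h0]
  · simp [h1]
  · simp [h2]
  · simp only [Fin.reduceFinMk, Matrix.cons_val]
    rw [mul_mul_mul_comm, he, mul_inv_cancel₀ (pow_ne_zero 2 h3), one_mul]

/-- The logarithmic derivative of `A B C / N`. -/
def expansion (N A B C : ℝ → ℝ) (t : ℝ) : ℝ :=
  deriv A t / A t + deriv B t / B t + deriv C t / C t - deriv N t / N t

/-- Derivative of the `μ`-th flux of a diagonal divergence-form operator. -/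
theorem totalDeriv1_diagonal_flux {D : Set (Coord 4)} (hD : IsOpen D)
    {s : Coord 4 → ℝ} {G : Metric 4} {v : Coord 4 → Fin 4 → ℝ}
    (hG : ∀ p ∈ D, G p = Matrix.diagonal (v p)) (μ : Fin 4) {j : Jet2 4} (hj : j.1 ∈ D)
    {L : Coord 4 →L[ℝ] ℝ} (hL : HasFDerivAt (fun p => s p * v p μ) L j.1) :
    totalDeriv1 μ (fun i : Jet1 4 => s i.1 * ∑ ν, G i.1 μ ν * i.2.2 ν) j =
      L (basisVec μ) * j.2.2.1 μ + s j.1 * v j.1 μ * j.2.2.2 μ μ := by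
  have hev : (fun i : Jet1 4 => s i.1 * ∑ ν, G i.1 μ ν * i.2.2 ν) =ᶠ[nhds (j.1, j.2.1, j.2.2.1)]
      fun i => (s i.1 * v i.1 μ) * i.2.2 μ := by
    filter_upwards [(hD.preimage continuous_fst).mem_nhds hj] with i hi
    rw [hG i.1 hi, Finset.sum_eq_single μ]
    · rw [Matrix.diagonal_apply_eq, mul_assoc]
    · intro ν _ hν; rw [Matrix.diagonal_apply_ne _ hν.symm, zero_mul]
    · simp
  have h1 : HasFDerivAt (fun i : Jet1 4 => s i.1 * v i.1 μ)
      (L.comp (ContinuousLinearMap.fst ℝ _ _)) (j.1, j.2.1, j.2.2.1) :=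
    HasFDerivAt.comp (g := fun p => s p * v p μ) (f := Prod.fst) _ hL hasFDerivAt_fst
  have h2 : HasFDerivAt (fun i : Jet1 4 => i.2.2 μ)
      ((ContinuousLinearMap.proj (R := ℝ) μ).comp
        ((ContinuousLinearMap.snd ℝ ℝ (Fin 4 → ℝ)).comp
          (ContinuousLinearMap.snd ℝ (Coord 4) (ℝ × (Fin 4 → ℝ))))) (j.1, j.2.1, j.2.2.1) :=
    ((ContinuousLinearMap.proj (R := ℝ) μ).comp
        ((ContinuousLinearMap.snd ℝ ℝ (Fin 4 → ℝ)).comp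
          (ContinuousLinearMap.snd ℝ (Coord 4) (ℝ × (Fin 4 → ℝ))))).hasFDerivAt
  rw [totalDeriv1, hev.fderiv_eq, (h1.fun_mul h2).fderiv]
  simp [ContinuousLinearMap.proj]
  ring

/-- The logarithmic derivative is insensitive to sign. In this form the common factor `|N A B C|` of
the fluxes cancels without a case split. -/
theorem hasDerivAt_abs_comp {f : ℝ → ℝ} {f' t : ℝ} (h : HasDerivAt f f' t) (h0 : f t ≠ 0) :
    HasDerivAt (fun t => |f t|) (|f t| * (f' / f t)) t := by
  refine ((hasDerivAt_abs h0).comp t h).congr_deriv ?_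
  rcases lt_or_gt_of_ne h0 with h | h
  · rw [abs_of_neg h, sign_neg h]; field_simp; simp
  · rw [abs_of_pos h, sign_pos h]; field_simp; simp

/-- The Klein-Gordon operator of a Bianchi III metric in coordinates. -/
theorem kleinGordon_bianchiIII {I : Set ℝ} (hI : IsOpen I) {N A B C : ℝ → ℝ}
    (hN : DifferentiableOn ℝ N I) (hA : DifferentiableOn ℝ A I)
    (hB : DifferentiableOn ℝ B I) (hC : DifferentiableOn ℝ C I)
    (h0 : ∀ t ∈ I, N t ≠ 0 ∧ A t ≠ 0 ∧ B t ≠ 0 ∧ C t ≠ 0)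
    (V : Coord 4 → ℝ) {j : Jet2 4} (hj : j.1 ∈ slab I) :
    kleinGordon (bianchiIII N A B C) V j =
      -((N (j.1 0)) ^ 2)⁻¹ * (j.2.2.2 0 0 + expansion N A B C (j.1 0) * j.2.2.1 0)
      + ((A (j.1 0)) ^ 2)⁻¹ * (j.2.2.2 1 1 - j.2.2.1 1)
      + ((B (j.1 0)) ^ 2)⁻¹ * j.2.2.2 2 2
      + ((C (j.1 0)) ^ 2)⁻¹ * Real.exp (2 * j.1 1) * j.2.2.2 3 3 - V j.1 * j.2.1 := by
  have hjI : j.1 0 ∈ I := hj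
  have dN := (hN.differentiableAt (hI.mem_nhds hjI)).hasDerivAt
  have dA := (hA.differentiableAt (hI.mem_nhds hjI)).hasDerivAt
  have dB := (hB.differentiableAt (hI.mem_nhds hjI)).hasDerivAt
  have dC := (hC.differentiableAt (hI.mem_nhds hjI)).hasDerivAt
  obtain ⟨n0, a0, b0, c0⟩ := h0 _ hjI
  have hne : N (j.1 0) * A (j.1 0) * B (j.1 0) * C (j.1 0) ≠ 0 := by positivity
  have dR := hasDerivAt_abs_comp (((dN.fun_mul dA).fun_mul dB).fun_mul dC) hne
  have hinv : ∀ {f : ℝ → ℝ} {f' : ℝ}, HasDerivAt f f' (j.1 0) → f (j.1 0) ≠ 0 →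
      HasDerivAt (fun t => ((f t) ^ 2)⁻¹) (-(2 * f (j.1 0) * f') / (f (j.1 0) ^ 2) ^ 2) (j.1 0) := by
    intro f f' h h0
    refine ((h.pow 2).inv (pow_ne_zero 2 h0)).congr_deriv ?_
    simp
  have eexp : HasDerivAt (fun s : ℝ => Real.exp (-s)) (-Real.exp (-j.1 1)) (j.1 1) := by
    simpa using (hasDerivAt_neg (j.1 1)).exp
  have eexp2 : HasDerivAt (fun s : ℝ => Real.exp (2 * s)) (Real.exp (2 * j.1 1) * 2) (j.1 1) := by
    simpa using ((hasDerivAt_id (j.1 1)).const_mul 2).exp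
  have fS := (hasFDerivAt_comp_coord 0 dR).fun_mul (hasFDerivAt_comp_coord 1 eexp)
  have fN := fS.fun_mul (hasFDerivAt_comp_coord 0 (hinv dN n0).fun_neg)
  have fA := fS.fun_mul (hasFDerivAt_comp_coord 0 (hinv dA a0))
  have fB := fS.fun_mul (hasFDerivAt_comp_coord 0 (hinv dB b0))
  have fC := fS.fun_mul ((hasFDerivAt_comp_coord 0 (hinv dC c0)).fun_mul
    (hasFDerivAt_comp_coord 1 eexp2))
  have hG : ∀ p ∈ slab I, (bianchiIII N A B C p)⁻¹ = _ := fun p hp => bianchiIII_inv (h0 _ hp)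
  have t0 := totalDeriv1_diagonal_flux (isOpen_slab hI) (G := fun p => (bianchiIII N A B C p)⁻¹)
    hG 0 hj fN
  have t1 := totalDeriv1_diagonal_flux (isOpen_slab hI) (G := fun p => (bianchiIII N A B C p)⁻¹)
    hG 1 hj fA
  have t2 := totalDeriv1_diagonal_flux (isOpen_slab hI) (G := fun p => (bianchiIII N A B C p)⁻¹)
    hG 2 hj fB
  have t3 := totalDeriv1_diagonal_flux (isOpen_slab hI) (G := fun p => (bianchiIII N A B C p)⁻¹)
    hG 3 hj fC
  rw [kleinGordon]
  rw [Fin.sum_univ_four]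
  simp only [bianchiIII_sqrt_det]
  rw [t0, t1, t2, t3]
  have hab : |N (j.1 0) * A (j.1 0) * B (j.1 0) * C (j.1 0)| ≠ 0 := abs_ne_zero.2 hne
  have hex : Real.exp (-j.1 1) ≠ 0 := (Real.exp_pos _).ne'
  simp only [expansion, basisVec, add_apply, smul_apply,
    ContinuousLinearMap.proj_apply, smul_eq_mul, Matrix.cons_val]
  -- Both factors of the volume density become opaque nonzero quantities that cancel. What survives
  -- is `expansion` from the `t`-flux and the term `-u_x` from differentiating `e^{-x}`.
  generalize |N (j.1 0) * A (j.1 0) * B (j.1 0) * C (j.1 0)| = R at *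
  generalize Real.exp (-j.1 1) = E at *
  simp
  field_simp
  ring

/-! ### Prolongation of affine generators. -/

theorem totalDeriv0_affineField_xi (c α p β q γ : ℝ) (ψ : ℝ → ℝ) (μ ν : Fin 4) (j : Jet1 4) :
    totalDeriv0 μ (fun r => (affineField c α p β q γ ψ).xi r ν) j =
      ![0, 0, p, q] ν * (if μ = ν then 1 else 0) := by
  have key : ∀ (a b : ℝ) (i : Fin 4), totalDeriv0 μ (fun r => a * r.1 i + b) j =
      a * (if μ = i then 1 else 0) := by
    intro a b i
    have h : HasFDerivAt (fun r : Coord 4 × ℝ => a * r.1 i + b)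
        (a • (ContinuousLinearMap.proj (R := ℝ) i).comp
          (ContinuousLinearMap.fst ℝ (Coord 4) ℝ)) (j.1, j.2.1) :=
      (((ContinuousLinearMap.proj (R := ℝ) i).comp
          (ContinuousLinearMap.fst ℝ (Coord 4) ℝ)).hasFDerivAt.const_mul a).add_const b
    rw [totalDeriv0, h.fderiv]
    simp [basisVec, Pi.single_apply, eq_comm]
  fin_cases ν
  · simpa [affineField] using key 0 c 0
  · simpa [affineField] using key 0 α 1
  · simpa [affineField] using key p β 2
  · simpa [affineField] using key q γ 3

theorem eta1_affineField (c α p β q γ : ℝ) {ψ : ℝ → ℝ} (μ : Fin 4) {j : Jet1 4}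
    (hψ : DifferentiableAt ℝ ψ (j.1 0)) :
    eta1 (affineField c α p β q γ ψ) μ j =
      -(deriv ψ (j.1 0) * basisVec (n := 4) μ 0) * j.2.1
        - (ψ (j.1 0) + ![0, 0, p, q] μ) * j.2.2 μ := by
  have h1 : HasFDerivAt (fun r : Coord 4 × ℝ => ψ (r.1 0))
      ((deriv ψ (j.1 0) • ContinuousLinearMap.proj (R := ℝ) (0 : Fin 4)).comp
        (ContinuousLinearMap.fst ℝ (Coord 4) ℝ)) (j.1, j.2.1) :=
    HasFDerivAt.comp (g := fun r : Coord 4 => ψ (r 0)) (f := Prod.fst) _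
      (hasFDerivAt_comp_coord 0 hψ.hasDerivAt) hasFDerivAt_fst
  have h2 := h1.fun_neg.fun_mul (hasFDerivAt_snd (𝕜 := ℝ) (p := (j.1, j.2.1)))
  rw [eta1, Finset.sum_congr rfl fun ν _ => by rw [totalDeriv0_affineField_xi],
    Finset.sum_eq_single μ (fun ν _ hν => by simp [hν.symm]) (by simp)]
  rw [totalDeriv0]
  simp only [affineField]
  rw [h2.fderiv]
  simp
  ring

/-- Only the components with equal indices are needed, since the metric is diagonal and the equation
contains no mixed second derivatives. -/
theorem eta2_affineField {I : Set ℝ} (hI : IsOpen I) (c α p β q γ : ℝ) {ψ : ℝ → ℝ}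
    (hψ : DifferentiableOn ℝ ψ I) (hψ' : DifferentiableOn ℝ (deriv ψ) I) (μ : Fin 4) {j : Jet2 4}
    (hj : j.1 ∈ slab I) :
    eta2 (affineField c α p β q γ ψ) μ μ j =
      -(deriv (deriv ψ) (j.1 0) * basisVec (n := 4) μ 0 ^ 2) * j.2.1
        - 2 * (deriv ψ (j.1 0) * basisVec (n := 4) μ 0) * j.2.2.1 μ
        - (ψ (j.1 0) + 2 * ![0, 0, p, q] μ) * j.2.2.2 μ μ := by
  have hjI : j.1 0 ∈ I := hj
  have hd := (hψ.differentiableAt (hI.mem_nhds hjI)).hasDerivAt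
  have hd' := (hψ'.differentiableAt (hI.mem_nhds hjI)).hasDerivAt
  have hev : eta1 (affineField c α p β q γ ψ) μ =ᶠ[nhds (j.1, j.2.1, j.2.2.1)]
      fun i => -(deriv ψ (i.1 0) * basisVec (n := 4) μ 0) * i.2.1
        - (ψ (i.1 0) + ![0, 0, p, q] μ) * i.2.2 μ := by
    filter_upwards [((isOpen_slab hI).preimage continuous_fst).mem_nhds hj] with i hi
    exact eta1_affineField c α p β q γ μ (hψ.differentiableAt (hI.mem_nhds hi))
  have hc : ∀ {φ : ℝ → ℝ} {φ' : ℝ}, HasDerivAt φ φ' (j.1 0) →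
      HasFDerivAt (fun r : Jet1 4 => φ (r.1 0))
      ((φ' • ContinuousLinearMap.proj (R := ℝ) (0 : Fin 4)).comp
        (ContinuousLinearMap.fst ℝ (Coord 4) _)) (j.1, j.2.1, j.2.2.1) := fun h =>
    HasFDerivAt.comp (f := Prod.fst) (j.1, j.2.1, j.2.2.1)
      (hasFDerivAt_comp_coord 0 h) hasFDerivAt_fst
  have hu : HasFDerivAt (fun i : Jet1 4 => i.2.1)
      ((ContinuousLinearMap.fst ℝ ℝ (Fin 4 → ℝ)).comp
          (ContinuousLinearMap.snd ℝ (Coord 4) (ℝ × (Fin 4 → ℝ)))) (j.1, j.2.1, j.2.2.1) :=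
    ((ContinuousLinearMap.fst ℝ ℝ (Fin 4 → ℝ)).comp
          (ContinuousLinearMap.snd ℝ (Coord 4) (ℝ × (Fin 4 → ℝ)))).hasFDerivAt
  have hp : HasFDerivAt (fun i : Jet1 4 => i.2.2 μ)
      ((ContinuousLinearMap.proj (R := ℝ) μ).comp
        ((ContinuousLinearMap.snd ℝ ℝ (Fin 4 → ℝ)).comp
          (ContinuousLinearMap.snd ℝ (Coord 4) (ℝ × (Fin 4 → ℝ))))) (j.1, j.2.1, j.2.2.1) :=
    ((ContinuousLinearMap.proj (R := ℝ) μ).comp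
        ((ContinuousLinearMap.snd ℝ ℝ (Fin 4 → ℝ)).comp
          (ContinuousLinearMap.snd ℝ (Coord 4) (ℝ × (Fin 4 → ℝ))))).hasFDerivAt
  have h := ((((hc hd').mul_const (basisVec (n := 4) μ 0)).fun_neg).fun_mul hu).fun_sub
    (((hc hd).add_const (![0, 0, p, q] μ)).fun_mul hp)
  rw [eta2, totalDeriv1, hev.fderiv_eq, h.fderiv,
    Finset.sum_congr rfl fun ν _ => by rw [totalDeriv0_affineField_xi],
    Finset.sum_eq_single μ (fun ν _ hν => by simp [hν.symm]) (by simp)]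
  simp
  ring

/-- This reduces the action of the prolonged field on the equation to a one-variable derivative
along a straight line in jet space. -/
theorem fderiv_apply_of_hasDerivAt_line {E : Type*} [NormedAddCommGroup E] [NormedSpace ℝ E]
    {f : E → ℝ} {x v : E} {d : ℝ} (hf : DifferentiableAt ℝ f x)
    (h : HasDerivAt (fun s : ℝ => f (x + s • v)) d 0) : fderiv ℝ f x v = d := by
  have h1 : HasDerivAt (fun s : ℝ => x + s • v) v 0 := by
    simpa using ((hasDerivAt_id (0 : ℝ)).smul_const v).const_add x
  have h2 : HasFDerivAt f (fderiv ℝ f x) (x + (0 : ℝ) • v) := by simpa using hf.hasFDerivAt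
  exact (h2.comp_hasDerivAt (0 : ℝ) h1).unique h

/-- This is the scaling weight of an inverse metric coefficient. Stating the hypothesis without
dividing by `c` keeps the Killing case `c = 0` included. -/
theorem hasDerivAt_inv_sq_of_logDeriv {f : ℝ → ℝ} {t c k : ℝ} (hf : DifferentiableAt ℝ f t)
    (h0 : f t ≠ 0) (hk : c * deriv f t = k * f t) :
    HasDerivAt (fun s : ℝ => (f (t + s * c) ^ 2)⁻¹) (-2 * k * (f t ^ 2)⁻¹) 0 := by
  have h1 : HasDerivAt (fun s : ℝ => t + s * c) c 0 := by
    simpa using ((hasDerivAt_id (0 : ℝ)).mul_const c).const_add t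
  have h2 : HasDerivAt f (deriv f t) (t + 0 * c) := by simpa using hf.hasDerivAt
  have h3 := ((h2.comp (0 : ℝ) h1).fun_pow 2).fun_inv (by simpa using h0)
  refine h3.congr_deriv ?_
  rw [mul_comm (deriv f t) c, hk]
  simp only [Function.comp_apply, zero_mul, add_zero]
  field_simp
  simp
  ring

theorem contDiffOn_deriv {I : Set ℝ} (hI : IsOpen I) {f : ℝ → ℝ} (hf : ContDiffOn ℝ ∞ f I) :
    ContDiffOn ℝ ∞ (deriv f) I :=
  hf.deriv_of_isOpen hI (by exact_mod_cast le_top)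

set_option maxHeartbeats 400000 in
/-- The second prolongation of a conformal Killing generator of a Bianchi III metric, acting on the
Klein-Gordon equation. -/
theorem prolong2_kleinGordon {I : Set ℝ} (hI : IsOpen I) {N A B C ψ : ℝ → ℝ}
    (hN : ContDiffOn ℝ ∞ N I) (hA : ContDiffOn ℝ ∞ A I)
    (hB : ContDiffOn ℝ ∞ B I) (hC : ContDiffOn ℝ ∞ C I) (hψ : ContDiffOn ℝ ∞ ψ I)
    (h0 : ∀ t ∈ I, N t ≠ 0 ∧ A t ≠ 0 ∧ B t ≠ 0 ∧ C t ≠ 0)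
    {c α p β q γ : ℝ}
    (kN : ∀ t ∈ I, c * deriv N t = ψ t * N t) (kA : ∀ t ∈ I, c * deriv A t = ψ t * A t)
    (kB : ∀ t ∈ I, c * deriv B t = (ψ t - p) * B t)
    (kC : ∀ t ∈ I, c * deriv C t = (ψ t - (q - α)) * C t)
    {V : Coord 4 → ℝ} {j : Jet2 4} (hj : j.1 ∈ slab I) (hV : DifferentiableAt ℝ V j.1) :
    fderiv ℝ (kleinGordon (bianchiIII N A B C) V) j
        (prolong2 (affineField c α p β q γ ψ) j) =
      -3 * ψ (j.1 0) * kleinGordon (bianchiIII N A B C) V j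
      + j.2.1 * ((N (j.1 0) ^ 2)⁻¹ *
          (deriv (deriv ψ) (j.1 0) + expansion N A B C (j.1 0) * deriv ψ (j.1 0))
        - fderiv ℝ V j.1 ![c, α, p * j.1 2 + β, q * j.1 3 + γ] - 2 * ψ (j.1 0) * V j.1) := by
  have hjI : j.1 0 ∈ I := hj
  have hIn := hI.mem_nhds hjI
  have dOn : ∀ {f : ℝ → ℝ}, ContDiffOn ℝ ∞ f I → DifferentiableOn ℝ f I := fun h =>
    h.differentiableOn (by simp)
  have dOn' : ∀ {f : ℝ → ℝ}, ContDiffOn ℝ ∞ f I → DifferentiableOn ℝ (deriv f) I := fun h =>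
    (contDiffOn_deriv hI h).differentiableOn (by simp)
  have dN := (dOn hN).differentiableAt hIn
  have dA := (dOn hA).differentiableAt hIn
  have dB := (dOn hB).differentiableAt hIn
  have dC := (dOn hC).differentiableAt hIn
  have dN' := (dOn' hN).differentiableAt hIn
  have dA' := (dOn' hA).differentiableAt hIn
  have dB' := (dOn' hB).differentiableAt hIn
  have dC' := (dOn' hC).differentiableAt hIn
  have dψ := (dOn hψ).differentiableAt hIn
  obtain ⟨n0, a0, b0, c0⟩ := h0 _ hjI
  have dσ : DifferentiableAt ℝ (expansion N A B C) (j.1 0) := by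
    unfold expansion
    fun_prop (disch := assumption)
  -- The four scaling equations add up to `c σ = 2ψ - p - (q - α)` for `σ = expansion`.
  -- Differentiating gives the identity that cancels the `u_t` terms of the prolongation.
  have hσ : c * deriv (expansion N A B C) (j.1 0) = 2 * deriv ψ (j.1 0) := by
    have e : (fun s => c * expansion N A B C s) =ᶠ[nhds (j.1 0)]
        fun s => 2 * ψ s - (p + (q - α)) := by
      filter_upwards [hIn] with s hs
      obtain ⟨n0, a0, b0, c0⟩ := h0 _ hs
      have e1 := kN s hs
      have e2 := kA s hs
      have e3 := kB s hs
      have e4 := kC s hs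
      simp only [expansion, mul_add, mul_sub, ← mul_div_assoc, e1, e2, e3, e4]
      field_simp
      ring
    have h1 := dσ.hasDerivAt.const_mul c
    have h2 := (dψ.hasDerivAt.const_mul 2).sub_const (p + (q - α))
    exact h1.unique (h2.congr_of_eventuallyEq e)
  have cd : ∀ {f : ℝ → ℝ}, DifferentiableAt ℝ f (j.1 0) →
      DifferentiableAt ℝ (fun i : Jet2 4 => f (i.1 0)) j := fun hf =>
    DifferentiableAt.comp (g := _) (f := fun i : Jet2 4 => i.1 0) j hf (by fun_prop)
  have hVd : DifferentiableAt ℝ (fun i : Jet2 4 => V i.1) j :=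
    DifferentiableAt.comp (g := V) (f := fun i : Jet2 4 => i.1) j hV (by fun_prop)
  have hev := Filter.eventuallyEq_of_mem (((isOpen_slab hI).preimage continuous_fst).mem_nhds hj)
    fun i hi => kleinGordon_bianchiIII hI (dOn hN) (dOn hA) (dOn hB) (dOn hC) h0 V hi
  rw [hev.fderiv_eq, hev.eq_of_nhds]
  have hdiff : DifferentiableAt ℝ (fun j : Jet2 4 =>
      -((N (j.1 0)) ^ 2)⁻¹ * (j.2.2.2 0 0 + expansion N A B C (j.1 0) * j.2.2.1 0)
      + ((A (j.1 0)) ^ 2)⁻¹ * (j.2.2.2 1 1 - j.2.2.1 1)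
      + ((B (j.1 0)) ^ 2)⁻¹ * j.2.2.2 2 2
      + ((C (j.1 0)) ^ 2)⁻¹ * Real.exp (2 * j.1 1) * j.2.2.2 3 3 - V j.1 * j.2.1) j := by
    have := cd dN
    have := cd dA
    have := cd dB
    have := cd dC
    have := cd dσ
    have := pow_ne_zero 2 n0
    have := pow_ne_zero 2 a0
    have := pow_ne_zero 2 b0
    have := pow_ne_zero 2 c0
    fun_prop (disch := assumption)
  set X := affineField c α p β q γ ψ
  have hξ : X.xi (j.1, j.2.1) = ![c, α, p * j.1 2 + β, q * j.1 3 + γ] := rfl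
  have line : ∀ a b : ℝ, HasDerivAt (fun s : ℝ => a + s * b) b 0 := fun a b => by
    simpa using ((hasDerivAt_id (0 : ℝ)).mul_const b).const_add a
  have lN := hasDerivAt_inv_sq_of_logDeriv dN n0 (kN _ hjI)
  have lA := hasDerivAt_inv_sq_of_logDeriv dA a0 (kA _ hjI)
  have lB := hasDerivAt_inv_sq_of_logDeriv dB b0 (kB _ hjI)
  have lC := hasDerivAt_inv_sq_of_logDeriv dC c0 (kC _ hjI)
  have lE : HasDerivAt (fun s : ℝ => Real.exp (2 * (j.1 1 + s * α)))
      (Real.exp (2 * j.1 1) * (2 * α)) 0 := by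
    simpa using ((line (j.1 1) α).const_mul 2).exp
  have lσ : HasDerivAt (fun s : ℝ => expansion N A B C (j.1 0 + s * c))
      (2 * deriv ψ (j.1 0)) 0 := by
    have h2 : HasDerivAt (expansion N A B C) (deriv (expansion N A B C) (j.1 0))
      (j.1 0 + 0 * c) := by simpa using dσ.hasDerivAt
    refine (h2.comp (0 : ℝ) (line _ c)).congr_deriv ?_
    rw [mul_comm, hσ]
  have lV : HasDerivAt (fun s : ℝ => V (j.1 + s • X.xi (j.1, j.2.1)))
      (fderiv ℝ V j.1 (X.xi (j.1, j.2.1))) 0 := by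
    have h1 : HasDerivAt (fun s : ℝ => j.1 + s • X.xi (j.1, j.2.1)) (X.xi (j.1, j.2.1)) 0 := by
      simpa using ((hasDerivAt_id (0 : ℝ)).smul_const (X.xi (j.1, j.2.1))).const_add j.1
    have h2 : HasFDerivAt V (fderiv ℝ V j.1) (j.1 + (0 : ℝ) • X.xi (j.1, j.2.1)) := by
      simpa using hV.hasFDerivAt
    exact h2.comp_hasDerivAt (0 : ℝ) h1
  have l2 : ∀ μ, HasDerivAt (fun s : ℝ => j.2.2.2 μ μ + s * eta2 X μ μ j) (eta2 X μ μ j) 0 :=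
    fun μ => line _ _
  have l1 : ∀ μ, HasDerivAt
      (fun s : ℝ => j.2.2.1 μ + s * eta1 X μ (j.1, j.2.1, j.2.2.1)) _ 0 := fun μ => line _ _
  have lu := line j.2.1 (X.eta (j.1, j.2.1))
  have tot := ((((lN.fun_neg.fun_mul ((l2 0).fun_add (lσ.fun_mul (l1 0)))).fun_add
    (lA.fun_mul ((l2 1).fun_sub (l1 1)))).fun_add (lB.fun_mul (l2 2))).fun_add
    ((lC.fun_mul lE).fun_mul (l2 3))).fun_sub (lV.fun_mul lu)
  have tot' := fderiv_apply_of_hasDerivAt_line (v := prolong2 X j) hdiff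
    (tot.congr_of_eventuallyEq (.of_forall fun s => by
      simp [prolong2, X, affineField]))
  rw [tot']
  simp only [zero_mul, add_zero, zero_smul, hξ]
  rw [eta2_affineField hI c α p β q γ (dOn hψ) (dOn' hψ) 0 hj,
    eta2_affineField hI c α p β q γ (dOn hψ) (dOn' hψ) 1 hj,
    eta2_affineField hI c α p β q γ (dOn hψ) (dOn' hψ) 2 hj,
    eta2_affineField hI c α p β q γ (dOn hψ) (dOn' hψ) 3 hj,
    eta1_affineField c α p β q γ 0 dψ, eta1_affineField c α p β q γ 1 dψ]
  simp [X, affineField, basisVec]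
  ring

/-! ### The determining equation for the potential. -/

theorem contDiffOn_affineField {I : Set ℝ} {ψ : ℝ → ℝ} (hψ : ContDiffOn ℝ ∞ ψ I)
    (c α p β q γ : ℝ) :
    ContDiffOn ℝ ∞ (affineField c α p β q γ ψ).xi (slab I ×ˢ Set.univ) ∧
      ContDiffOn ℝ ∞ (affineField c α p β q γ ψ).eta (slab I ×ˢ Set.univ) := by
  constructor
  · refine ContDiff.contDiffOn (contDiff_pi.2 fun i => ?_)
    fin_cases i <;> simp [affineField] <;> fun_prop
  · have h : ContDiffOn ℝ ∞ (fun r : Coord 4 × ℝ => ψ (r.1 0)) (slab I ×ˢ Set.univ) :=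
      hψ.comp (f := fun r : Coord 4 × ℝ => r.1 0) (by fun_prop) fun r hr => hr.1
    exact h.neg.mul (by fun_prop)

/-- Determining equation for the potential. -/
theorem isLieSymmetry_affineField_iff {I : Set ℝ} (hI : IsOpen I) {N A B C ψ : ℝ → ℝ}
    (hN : ContDiffOn ℝ ∞ N I) (hA : ContDiffOn ℝ ∞ A I)
    (hB : ContDiffOn ℝ ∞ B I) (hC : ContDiffOn ℝ ∞ C I) (hψ : ContDiffOn ℝ ∞ ψ I)
    (h0 : ∀ t ∈ I, N t ≠ 0 ∧ A t ≠ 0 ∧ B t ≠ 0 ∧ C t ≠ 0)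
    {c α p β q γ : ℝ}
    (kN : ∀ t ∈ I, c * deriv N t = ψ t * N t) (kA : ∀ t ∈ I, c * deriv A t = ψ t * A t)
    (kB : ∀ t ∈ I, c * deriv B t = (ψ t - p) * B t)
    (kC : ∀ t ∈ I, c * deriv C t = (ψ t - (q - α)) * C t)
    {V : Coord 4 → ℝ} (hV : ContDiffOn ℝ ∞ V (slab I)) :
    IsLieSymmetry (slab I) (kleinGordon (bianchiIII N A B C) V)
        (affineField c α p β q γ ψ) ↔
      ∀ r ∈ slab I, fderiv ℝ V r ![c, α, p * r 2 + β, q * r 3 + γ] + 2 * ψ (r 0) * V r =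
        (N (r 0) ^ 2)⁻¹ *
          (deriv (deriv ψ) (r 0) + expansion N A B C (r 0) * deriv ψ (r 0)) := by
  have dV : ∀ r ∈ slab I, DifferentiableAt ℝ V r := fun r hr =>
    (hV.differentiableOn (by simp)).differentiableAt ((isOpen_slab hI).mem_nhds hr)
  constructor
  · rintro ⟨-, -, h⟩ r hr
    obtain ⟨n0, a0, b0, c0⟩ := h0 _ hr
    -- A test jet on the equation with `u = 1` and zero gradient: `u_{xx} = A² V` balances `V u`, so
    -- only the bracket multiplying `u` remains.
    let j : Jet2 4 := (r, 1, 0, fun μ ν => if μ = 1 ∧ ν = 1 then A (r 0) ^ 2 * V r else 0)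
    have hj : kleinGordon (bianchiIII N A B C) V j = 0 := by
      rw [kleinGordon_bianchiIII hI (hN.differentiableOn (by simp))
        (hA.differentiableOn (by simp)) (hB.differentiableOn (by simp))
        (hC.differentiableOn (by simp)) h0 V hr]
      simp [j]
      field_simp
      ring
    have h1 := h j hr (fun μ ν => by simp [j, and_comm]) hj
    rw [prolong2_kleinGordon hI hN hA hB hC hψ h0 kN kA kB kC hr (dV r hr), hj] at h1
    simp only [j] at h1
    linarith
  · intro h
    obtain ⟨s1, s2⟩ := contDiffOn_affineField hψ c α p β q γ
    refine ⟨s1, s2, fun j hj _ hH => ?_⟩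
    rw [prolong2_kleinGordon hI hN hA hB hC hψ h0 kN kA kB kC hj (dV _ hj), hH, ← h _ hj]
    ring

/-! ### The conformal Killing equation for affine fields. -/

theorem pd_affine (c α p β q γ : ℝ) (μ κ : Fin 4) (r : Coord 4) :
    pd μ (fun y : Coord 4 => (![c, α, p * y 2 + β, q * y 3 + γ] : Coord 4) κ) r =
      ![0, 0, p, q] κ * (if μ = κ then 1 else 0) := by
  have key : ∀ (a b : ℝ) (i : Fin 4), pd μ (fun y => a * y i + b) r =
      a * (if μ = i then 1 else 0) := by
    intro a b i
    have h : HasFDerivAt (fun y : Coord 4 => a * y i + b)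
        (a • (ContinuousLinearMap.proj (R := ℝ) i)) r :=
      ((ContinuousLinearMap.proj (R := ℝ) (φ := fun _ : Fin 4 => ℝ) i).hasFDerivAt.const_mul
        a).add_const b
    rw [pd, h.fderiv]
    simp [basisVec, Pi.single_apply, eq_comm]
  fin_cases κ
  · simpa using key 0 c 0
  · simpa using key 0 α 1
  · simpa using key p β 2
  · simpa using key q γ 3

theorem sum_mul_pd {n : ℕ} (v : Coord n) (f : Coord n → ℝ) (r : Coord n) :
    ∑ κ, v κ * pd κ f r = fderiv ℝ f r v := by
  conv_rhs => rw [pi_eq_sum_univ' v, map_sum]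
  refine Finset.sum_congr rfl fun κ _ => ?_
  rw [map_smul, smul_eq_mul, pd, basisVec]

/-- Conformal Killing equation for affine vector fields on Bianchi III metrics. -/
theorem isCKV_affine {I : Set ℝ} (hI : IsOpen I) {N A B C ψ : ℝ → ℝ}
    (hN : ContDiffOn ℝ ∞ N I) (hA : ContDiffOn ℝ ∞ A I)
    (hB : ContDiffOn ℝ ∞ B I) (hC : ContDiffOn ℝ ∞ C I)
    {c α p β q γ : ℝ}
    (kN : ∀ t ∈ I, c * deriv N t = ψ t * N t) (kA : ∀ t ∈ I, c * deriv A t = ψ t * A t)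
    (kB : ∀ t ∈ I, c * deriv B t = (ψ t - p) * B t)
    (kC : ∀ t ∈ I, c * deriv C t = (ψ t - (q - α)) * C t) :
    IsCKV (slab I) (bianchiIII N A B C) (fun r => ![c, α, p * r 2 + β, q * r 3 + γ])
      (fun r => ψ (r 0)) := by
  intro r hr μ ν
  have hrI : r 0 ∈ I := hr
  have hd : ∀ {f : ℝ → ℝ}, ContDiffOn ℝ ∞ f I → HasFDerivAt (fun y : Coord 4 => f (y 0) ^ 2)
      ((2 * f (r 0) * deriv f (r 0)) • ContinuousLinearMap.proj (R := ℝ) (0 : Fin 4)) r := by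
    intro f hf
    have h1 := ((hf.differentiableOn (by simp)).differentiableAt (hI.mem_nhds hrI)).hasDerivAt
    exact hasFDerivAt_comp_coord 0 ((h1.fun_pow 2).congr_deriv (by simp))
  have he : HasFDerivAt (fun y : Coord 4 => Real.exp (-2 * y 1))
      ((Real.exp (-2 * r 1) * -2) • ContinuousLinearMap.proj (R := ℝ) (1 : Fin 4)) r := by
    have h1 : HasDerivAt (fun s : ℝ => Real.exp (-2 * s)) (Real.exp (-2 * r 1) * -2) (r 1) := by
      simpa using ((hasDerivAt_id (r 1)).const_mul (-2)).exp
    exact hasFDerivAt_comp_coord 1 h1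
  simp only [lieMetric, Finset.sum_add_distrib, sum_mul_pd, pd_affine]
  by_cases hμν : μ = ν
  · subst hμν
    have e := kN _ hrI
    have e2 := kA _ hrI
    have e3 := kB _ hrI
    have e4 := kC _ hrI
    simp only [bianchiIII, Matrix.diagonal_apply_eq, Matrix.diagonal_apply, Fin.sum_univ_four]
    fin_cases μ
    · have h := hd hN
      simp
      rw [h.fderiv]
      simp
      linear_combination (2 * N (r 0)) * e
    · have h := (hd hA)
      simp
      rw [h.fderiv]
      simp
      linear_combination (2 * A (r 0)) * e2
    · have h := (hd hB)
      simp
      rw [h.fderiv]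
      simp
      linear_combination (2 * B (r 0)) * e3
    -- Moving along `α ∂_x` scales `e^{-2x}` by weight `-2α`, which is why `kC` involves `q - α` and
    -- not `q`.
    · have h := (hd hC).fun_mul he
      simp at h ⊢
      rw [h.fderiv]
      simp
      linear_combination (2 * C (r 0) * Real.exp (-(2 * r 1))) * e4
  · have hz : ∀ y, bianchiIII N A B C y μ ν = 0 := fun y => Matrix.diagonal_apply_ne _ hμν
    rw [Finset.sum_eq_single μ (fun κ _ h => by simp [h.symm]) (by simp),
      Finset.sum_eq_single ν (fun κ _ h => by simp [h.symm]) (by simp)]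
    simp [hz]

/-! ### Functions invariant under a flow. -/

/-- A function annihilated by a complete transversal flow is a function of the flow invariants. -/
theorem forall_fderiv_eq_zero_iff_exists {E F : Type*} [NormedAddCommGroup E] [NormedSpace ℝ E]
    [NormedAddCommGroup F] [NormedSpace ℝ F] {D : Set E} (hD : IsOpen D) {W : E → ℝ}
    (hW : ContDiffOn ℝ ∞ W D) {ξ : E → E} {P : Set F} {J : Set ℝ} (hJ : IsOpen J)
    (hJc : IsPreconnected J) {s₀ : ℝ} (hs₀ : s₀ ∈ J) {k : ℝ} (hk : k ≠ 0) (Φ : F → ℝ → E)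
    (hΦ : ∀ a ∈ P, ∀ s ∈ J, Φ a s ∈ D ∧ HasDerivAt (Φ a) (k • ξ (Φ a s)) s)
    (hΦ₀ : ContDiffOn ℝ ∞ (fun a => Φ a s₀) P) (π : E → F) (τ : E → ℝ)
    (hπ : ∀ r ∈ D, π r ∈ P ∧ τ r ∈ J ∧ Φ (π r) (τ r) = r)
    (hπΦ : ∀ a ∈ P, ∀ s ∈ J, π (Φ a s) = a) :
    (∀ r ∈ D, fderiv ℝ W r (ξ r) = 0) ↔
      ∃ U : F → ℝ, ContDiffOn ℝ ∞ U P ∧ ∀ r ∈ D, W r = U (π r) := by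
  -- The curves `Φ a` are orbits of `ξ` run at speed `k`, so a coordinate can serve as the orbit
  -- parameter.
  have hder : ∀ a ∈ P, ∀ s ∈ J, HasDerivAt (fun s => W (Φ a s))
      (k * fderiv ℝ W (Φ a s) (ξ (Φ a s))) s := by
    intro a ha s hs
    obtain ⟨h1, h2⟩ := hΦ a ha s hs
    have h3 := ((hW.differentiableOn (by simp)).differentiableAt (hD.mem_nhds h1)).hasFDerivAt
    exact (h3.comp_hasDerivAt s h2).congr_deriv (by simp)
  constructor
  · intro h
    -- `U` is the restriction of `W` to the cross-section `s = s₀`. Connectedness of `J` carries the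
    -- value from there along the whole orbit.
    refine ⟨fun a => W (Φ a s₀), hW.comp hΦ₀ fun a ha => (hΦ a ha s₀ hs₀).1, fun r hr => ?_⟩
    obtain ⟨h1, h2, h3⟩ := hπ r hr
    have h4 := hJ.is_const_of_deriv_eq_zero hJc
      (fun s hs => (hder _ h1 s hs).differentiableAt.differentiableWithinAt)
      (fun s hs => by
        rw [(hder _ h1 s hs).deriv, h _ (hΦ _ h1 s hs).1, mul_zero, Pi.zero_apply]) h2 hs₀
    simpa only [h3] using h4
  · rintro ⟨U, -, hU⟩ r hr
    obtain ⟨h1, h2, h3⟩ := hπ r hr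
    have h4 : (fun s => W (Φ (π r) s)) =ᶠ[nhds (τ r)] fun _ => U (π r) := by
      filter_upwards [hJ.mem_nhds h2] with s hs
      rw [hU _ (hΦ _ h1 s hs).1, hπΦ _ h1 s hs]
    have h5 := (hder _ h1 _ h2).unique ((hasDerivAt_const (τ r) (U (π r))).congr_of_eventuallyEq h4)
    rw [h3] at h5
    exact (mul_eq_zero.1 h5).resolve_left hk

theorem forall_mem_slab {I : Set ℝ} {Q : Coord 4 → Prop} :
    (∀ r ∈ slab I, Q r) ↔ ∀ t ∈ I, ∀ x y z : ℝ, Q ![t, x, y, z] := by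
  constructor
  · intro h t ht x y z
    exact h _ ht
  · intro h r hr
    have e : r = ![r 0, r 1, r 2, r 3] := by funext i; fin_cases i <;> rfl
    rw [e]
    exact h _ hr _ _ _

theorem hasDerivAt_vec4 {f g h k : ℝ → ℝ} {f' g' h' k' s : ℝ} (hf : HasDerivAt f f' s)
    (hg : HasDerivAt g g' s) (hh : HasDerivAt h h' s) (hk : HasDerivAt k k' s) :
    HasDerivAt (fun s => (![f s, g s, h s, k s] : Coord 4)) ![f', g', h', k'] s := by
  rw [hasDerivAt_pi]
  intro i
  fin_cases i <;> assumption

/-- Orbits are parametrized by `x` itself, hence speed `1/α`: `y` has slope `β/α`, and `z + γ/α`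
grows like `e^x`. Since `t` is an invariant, `U` is smooth over `I` in its first slot only. -/
theorem invariant_homothetic_iff {I : Set ℝ} (hI : IsOpen I) {V : Coord 4 → ℝ}
    (hV : ContDiffOn ℝ ∞ V (slab I)) {α : ℝ} (hα : α ≠ 0) (β γ : ℝ) :
    (∀ r ∈ slab I, fderiv ℝ V r ![0, α, β, α * r 3 + γ] = 0) ↔
      ∃ U : ℝ × ℝ × ℝ → ℝ, ContDiffOn ℝ ∞ U (I ×ˢ Set.univ) ∧
        ∀ t ∈ I, ∀ x y z : ℝ, V ![t, x, y, z] =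
          U (t, y - β / α * x, (z + γ / α) * Real.exp (-x)) := by
  have h := forall_fderiv_eq_zero_iff_exists (isOpen_slab hI) hV
    (ξ := fun r : Coord 4 => ![0, α, β, α * r 3 + γ]) (P := I ×ˢ Set.univ)
    isOpen_univ isPreconnected_univ (Set.mem_univ (0 : ℝ)) (inv_ne_zero hα)
    (fun (a : ℝ × ℝ × ℝ) s => ![a.1, s, a.2.1 + s * (β / α), a.2.2 * Real.exp s - γ / α])
    (fun a ha s _ => ⟨ha.1, by
      refine (hasDerivAt_vec4 (hasDerivAt_const s _) (hasDerivAt_id s)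
        (((hasDerivAt_id s).mul_const (β / α)).const_add a.2.1)
        (((Real.hasDerivAt_exp s).const_mul a.2.2).sub_const (γ / α))).congr_deriv ?_
      funext i
      fin_cases i <;> simp <;> field_simp
      ring⟩)
    (by
      refine ContDiff.contDiffOn (contDiff_pi.2 fun i => ?_)
      fin_cases i <;> simp <;> fun_prop)
    (fun r => (r 0, r 2 - β / α * r 1, (r 3 + γ / α) * Real.exp (-r 1))) (fun r => r 1)
    (fun r hr => ⟨⟨hr, trivial⟩, trivial, by
      funext i
      fin_cases i <;> simp [mul_assoc, ← Real.exp_add]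
      ring⟩)
    (fun a ha s _ => by
      refine Prod.ext rfl (Prod.ext ?_ ?_) <;> simp [mul_assoc, ← Real.exp_add]
      ring)
  rw [h]
  simp only [forall_mem_slab]
  simp

/-- Orbits are lines of direction `(β, γ)` in the `(y, z)`-plane, based at the foot of the
perpendicular from the origin. This choice treats `β = 0` and `γ = 0` uniformly. -/
theorem invariant_translation_iff {I : Set ℝ} (hI : IsOpen I) {V : Coord 4 → ℝ}
    (hV : ContDiffOn ℝ ∞ V (slab I)) {β γ : ℝ} (hβγ : β ≠ 0 ∨ γ ≠ 0) :
    (∀ r ∈ slab I, fderiv ℝ V r ![0, 0, β, γ] = 0) ↔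
      ∃ U : ℝ × ℝ × ℝ → ℝ, ContDiffOn ℝ ∞ U (I ×ˢ Set.univ) ∧
        ∀ t ∈ I, ∀ x y z : ℝ, V ![t, x, y, z] = U (t, x, β * z - γ * y) := by
  have hn : β ^ 2 + γ ^ 2 ≠ 0 := by
    rcases hβγ with h | h <;> positivity
  have h := forall_fderiv_eq_zero_iff_exists (isOpen_slab hI) hV
    (ξ := fun _ : Coord 4 => ![0, 0, β, γ]) (P := I ×ˢ Set.univ)
    isOpen_univ isPreconnected_univ (Set.mem_univ (0 : ℝ)) one_ne_zero
    (fun (a : ℝ × ℝ × ℝ) s => ![a.1, a.2.1, -γ * a.2.2 / (β ^ 2 + γ ^ 2) + s * β,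
      β * a.2.2 / (β ^ 2 + γ ^ 2) + s * γ])
    (fun a ha s _ => ⟨ha.1, by
      refine (hasDerivAt_vec4 (hasDerivAt_const s _) (hasDerivAt_const s _)
        (((hasDerivAt_id s).mul_const β).const_add _)
        (((hasDerivAt_id s).mul_const γ).const_add _)).congr_deriv ?_
      funext i
      fin_cases i <;> simp⟩)
    (by
      refine ContDiff.contDiffOn (contDiff_pi.2 fun i => ?_)
      fin_cases i <;> simp <;> fun_prop)
    (fun r => (r 0, r 1, β * r 3 - γ * r 2)) (fun r => (β * r 2 + γ * r 3) / (β ^ 2 + γ ^ 2))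
    (fun r hr => ⟨⟨hr, trivial⟩, trivial, by
      funext i
      fin_cases i <;> simp <;> field_simp <;> ring⟩)
    (fun a ha s _ => by
      refine Prod.ext rfl (Prod.ext rfl ?_)
      simp
      field_simp
      ring)
  rw [h]
  simp only [forall_mem_slab]
  simp

/-! ### The explicit term and the rescaled potential. -/

theorem contDiffOn_mul_exp {I : Set ℝ} {A : ℝ → ℝ} (hA : ContDiffOn ℝ ∞ A I) (k : ℝ) :
    ContDiffOn ℝ ∞ (fun t => A t * Real.exp (k * t / 2)) I :=
  hA.mul (by fun_prop)

theorem hasDerivAt_mul_exp_half {A : ℝ → ℝ} {t : ℝ} (hA : DifferentiableAt ℝ A t) (k : ℝ) :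
    HasDerivAt (fun t => A t * Real.exp (k * t / 2))
      ((deriv A t + k / 2 * A t) * Real.exp (k * t / 2)) t := by
  have h : HasDerivAt (fun t => Real.exp (k * t / 2)) (Real.exp (k * t / 2) * (k / 2)) t := by
    simpa using (((hasDerivAt_id t).const_mul k).div_const 2).exp
  exact (hA.hasDerivAt.fun_mul h).congr_deriv (by ring)

theorem contDiffOn_confFactor {I : Set ℝ} (hI : IsOpen I) {A : ℝ → ℝ} (hA : ContDiffOn ℝ ∞ A I)
    (h0 : ∀ t ∈ I, A t ≠ 0) (m l : ℝ) : ContDiffOn ℝ ∞ (confFactor A m l) I :=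
  (contDiffOn_const.mul ((contDiffOn_deriv hI hA).div hA h0)).add contDiffOn_const

theorem contDiffOn_explicitTerm {I : Set ℝ} (hI : IsOpen I) {A : ℝ → ℝ} (hA : ContDiffOn ℝ ∞ A I)
    (h0 : ∀ t ∈ I, A t ≠ 0) (m l : ℝ) : ContDiffOn ℝ ∞ (explicitTerm A m l) I := by
  have h1 := contDiffOn_deriv hI hA
  have h2 := contDiffOn_deriv hI h1
  refine ContDiffOn.div (ContDiffOn.mul (by fun_prop) ((contDiffOn_const.mul h1).add
    (contDiffOn_const.mul h2))) (contDiffOn_const.mul (hA.pow 3)) fun t ht => ?_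
  have := h0 t ht
  positivity

/-- The explicit term solves the inhomogeneous transport equation. -/
theorem explicitTerm_transport {I : Set ℝ} (hI : IsOpen I) {A : ℝ → ℝ} (hA : ContDiffOn ℝ ∞ A I)
    (h0 : ∀ t ∈ I, A t ≠ 0) {m : ℝ} (hm : m ≠ 0) (l : ℝ) {t : ℝ} (ht : t ∈ I) :
    2 / m * deriv (explicitTerm A m l) t + 2 * confFactor A m l t * explicitTerm A m l t =
      ((A t * Real.exp (m * l * t / 2)) ^ 2)⁻¹ * (deriv (deriv (confFactor A m l)) t +
        expansion (fun t => A t * Real.exp (m * l * t / 2))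
          (fun t => A t * Real.exp (m * l * t / 2))
          (fun t => A t * Real.exp (m * (l - 1) * t / 2)) A t * deriv (confFactor A m l) t) := by
  have hA1 := contDiffOn_deriv hI hA
  have hA2 := contDiffOn_deriv hI hA1
  have dOn : ∀ {f : ℝ → ℝ}, ContDiffOn ℝ ∞ f I → ∀ s ∈ I, DifferentiableAt ℝ f s := fun h s hs =>
    (h.differentiableOn (by simp)).differentiableAt (hI.mem_nhds hs)
  have p1 : ∀ s ∈ I, HasDerivAt (confFactor A m l)
      (2 / m * ((deriv (deriv A) s * A s - deriv A s * deriv A s) / A s ^ 2)) s := fun s hs =>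
    (((dOn hA1 s hs).hasDerivAt.fun_div (dOn hA s hs).hasDerivAt (h0 s hs)).const_mul
      (2 / m)).add_const l
  have dA := (dOn hA t ht).hasDerivAt
  have dA1 := (dOn hA1 t ht).hasDerivAt
  have dA2 := (dOn hA2 t ht).hasDerivAt
  have n0 := h0 t ht
  have e : deriv (confFactor A m l) =ᶠ[nhds t] fun s =>
      2 / m * ((deriv (deriv A) s * A s - deriv A s * deriv A s) / A s ^ 2) :=
    Filter.eventuallyEq_of_mem (hI.mem_nhds ht) fun s hs => (p1 s hs).deriv
  have p2 := e.deriv_eq.trans ((((dA2.fun_mul dA).fun_sub (dA1.fun_mul dA1)).fun_div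
    (dA.fun_pow 2) (pow_ne_zero 2 n0)).const_mul (2 / m)).deriv
  have hE : HasDerivAt (fun s : ℝ => Real.exp (-(m * l * s)))
      (Real.exp (-(m * l * t)) * -(m * l)) t := by
    simpa using ((hasDerivAt_id t).const_mul (m * l)).neg.exp
  have p3 : deriv (explicitTerm A m l) t = _ :=
    ((hE.fun_mul ((dA1.const_mul (m * (l - 1))).fun_add (dA2.const_mul 2))).fun_div
      ((dA.fun_pow 3).const_mul 2) (by positivity)).deriv
  have e1 := (hasDerivAt_mul_exp_half (dOn hA t ht) (m * (l - 1))).deriv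
  -- With `e^{-mλt}` as the common exponential, the claim becomes a rational identity in `A` and its
  -- derivatives.
  have e2 : (A t * Real.exp (m * l * t / 2)) ^ 2 = A t ^ 2 * (Real.exp (-(m * l * t)))⁻¹ := by
    rw [mul_pow, ← Real.exp_neg, ← Real.exp_nat_mul]; congr 2; push_cast; ring
  rw [(p1 t ht).deriv, p2, p3, expansion, e1, e2]
  have q1 := (Real.exp_pos (m * (l - 1) * t / 2)).ne'
  have q2 := (Real.exp_pos (-(m * l * t))).ne'
  simp only [confFactor, explicitTerm]
  simp
  field_simp
  ring

/-- Symmetry condition in terms of the rescaled potential. -/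
theorem rescaled_potential_transport {I : Set ℝ} (hI : IsOpen I) {A : ℝ → ℝ}
    (hA : ContDiffOn ℝ ∞ A I) (h0 : ∀ t ∈ I, A t ≠ 0) {m : ℝ} (hm : m ≠ 0) (l : ℝ)
    {V : Coord 4 → ℝ} (hV : ContDiffOn ℝ ∞ V (slab I)) {r v : Coord 4} (hr : r ∈ slab I)
    (hv : v 0 = 2 / m) :
    fderiv ℝ (fun r => A (r 0) ^ 2 * Real.exp (m * l * r 0) *
        (V r - explicitTerm A m l (r 0))) r v =
      A (r 0) ^ 2 * Real.exp (m * l * r 0) * (fderiv ℝ V r v + 2 * confFactor A m l (r 0) * V r -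
        (2 / m * deriv (explicitTerm A m l) (r 0) +
          2 * confFactor A m l (r 0) * explicitTerm A m l (r 0))) := by
  have hrI : r 0 ∈ I := hr
  have dOn : ∀ {f : ℝ → ℝ}, ContDiffOn ℝ ∞ f I → HasDerivAt f (deriv f (r 0)) (r 0) := fun h =>
    ((h.differentiableOn (by simp)).differentiableAt (hI.mem_nhds hrI)).hasDerivAt
  have hE : HasDerivAt (fun s : ℝ => Real.exp (m * l * s))
      (Real.exp (m * l * r 0) * (m * l)) (r 0) := by
    simpa using ((hasDerivAt_id (r 0)).const_mul (m * l)).exp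
  have h1 := hasFDerivAt_comp_coord 0 (((dOn hA).fun_pow 2).fun_mul hE)
  have h2 := hasFDerivAt_comp_coord 0 (dOn (contDiffOn_explicitTerm hI hA h0 m l))
  have h3 := ((hV.differentiableOn (by simp)).differentiableAt
    ((isOpen_slab hI).mem_nhds hr)).hasFDerivAt
  rw [(h1.fun_mul (h3.fun_sub h2)).fderiv]
  have n0 := h0 _ hrI
  simp [hv, confFactor]
  field_simp
  ring

/-- Invariance under `X₃ + αξ¹ + βξ² + γξ³`, for any integration `zc` of its `z`-component. -/
theorem invariant_X3_iff {I : Set ℝ} (hI : IsOpen I) (hIc : I.OrdConnected) {t₀ : ℝ}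
    (ht₀ : t₀ ∈ I) {W : Coord 4 → ℝ} (hW : ContDiffOn ℝ ∞ W (slab I)) {m : ℝ} (hm : m ≠ 0)
    (α β q γ : ℝ) {zc ζ : ℝ → ℝ → ℝ} (hzc : ContDiff ℝ ∞ fun Z => zc Z t₀)
    (hd : ∀ Z t, HasDerivAt (zc Z) (m / 2 * (q * zc Z t + γ)) t)
    (h1 : ∀ z t, zc (ζ z t) t = z) (h2 : ∀ Z t, ζ (zc Z t) t = Z) :
    (∀ r ∈ slab I, fderiv ℝ W r ![2 / m, α, r 2 + β, q * r 3 + γ] = 0) ↔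
      ∃ U : ℝ × ℝ × ℝ → ℝ, ContDiff ℝ ∞ U ∧
        ∀ t ∈ I, ∀ x y z : ℝ, W ![t, x, y, z] =
          U (x - α * m / 2 * t, (y + β) * Real.exp (-(m / 2 * t)), ζ z t) := by
  have h := forall_fderiv_eq_zero_iff_exists (isOpen_slab hI) hW
    (ξ := fun r : Coord 4 => ![2 / m, α, r 2 + β, q * r 3 + γ]) (P := Set.univ)
    -- Here `t` is the orbit parameter, so the speed is `m/2` and the parameter range is `I`, which
    -- must be connected. The invariants range over all of `ℝ³`.
    hI hIc.isPreconnected ht₀ (k := m / 2) (by positivity)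
    (fun (a : ℝ × ℝ × ℝ) t => ![t, a.1 + t * (α * m / 2), a.2.1 * Real.exp (m / 2 * t) - β,
      zc a.2.2 t])
    (fun a _ s hs => ⟨hs, by
      have hE : HasDerivAt (fun s : ℝ => Real.exp (m / 2 * s))
          (Real.exp (m / 2 * s) * (m / 2)) s := by
        simpa using ((hasDerivAt_id s).const_mul (m / 2)).exp
      refine (hasDerivAt_vec4 (hasDerivAt_id s)
        (((hasDerivAt_id s).mul_const (α * m / 2)).const_add a.1)
        ((hE.const_mul a.2.1).sub_const β) (hd a.2.2 s)).congr_deriv ?_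
      funext i
      fin_cases i <;> simp <;> field_simp⟩)
    (by
      refine ContDiff.contDiffOn (contDiff_pi.2 fun i => ?_)
      have := hzc.comp (contDiff_snd.snd' : ContDiff ℝ ∞ fun a : ℝ × ℝ × ℝ => a.2.2)
      fin_cases i
      · exact contDiff_const
      · simp; fun_prop
      · simp; fun_prop
      · exact this)
    (fun r => (r 1 - α * m / 2 * r 0, (r 2 + β) * Real.exp (-(m / 2 * r 0)), ζ (r 3) (r 0)))
    (fun r => r 0)
    (fun r hr => ⟨trivial, hr, by
      funext i
      fin_cases i <;> simp [mul_assoc, ← Real.exp_add, h1]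
      ring⟩)
    (fun a _ s _ => by
      refine Prod.ext ?_ (Prod.ext ?_ ?_) <;> simp [mul_assoc, ← Real.exp_add, h2]
      ring)
  rw [h]
  simp only [forall_mem_slab, contDiffOn_univ]
  simp

/-! ### Symmetries of the two families of metrics. -/

/-- Lie symmetries from Killing vectors of Bianchi III metrics. -/
theorem isLieSymmetry_xiComb_iff {I : Set ℝ} (hI : IsOpen I) {N A B C : ℝ → ℝ}
    (hN : ContDiffOn ℝ ∞ N I) (hA : ContDiffOn ℝ ∞ A I)
    (hB : ContDiffOn ℝ ∞ B I) (hC : ContDiffOn ℝ ∞ C I)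
    (h0 : ∀ t ∈ I, N t ≠ 0 ∧ A t ≠ 0 ∧ B t ≠ 0 ∧ C t ≠ 0)
    {V : Coord 4 → ℝ} (hV : ContDiffOn ℝ ∞ V (slab I)) (α β γ : ℝ) :
    IsLieSymmetry (slab I) (kleinGordon (bianchiIII N A B C) V) (horizontal (xiComb α β γ)) ↔
      ∀ r ∈ slab I, fderiv ℝ V r ![0, α, β, α * r 3 + γ] = 0 := by
  have e : horizontal (xiComb α β γ) = affineField 0 α 0 β α γ (fun _ => 0) := by
    simp only [horizontal, affineField, PointField.mk.injEq]
    refine ⟨?_, by simp⟩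
    funext r i
    fin_cases i <;> simp [xiComb, xi1, xi2, xi3]
  rw [e, isLieSymmetry_affineField_iff hI hN hA hB hC contDiffOn_const h0 (by simp) (by simp)
    (by simp) (by simp) hV]
  simp

theorem xi1_eq : xi1 = xiComb 1 0 0 := by
  funext r; simp [xiComb]

theorem xi2_eq : xi2 = xiComb 0 1 0 := by
  funext r; simp [xiComb]

theorem xi3_eq : xi3 = xiComb 0 0 1 := by
  funext r; simp [xiComb]

theorem isKV_xiComb {I : Set ℝ} (hI : IsOpen I) {N A B C : ℝ → ℝ}
    (hN : ContDiffOn ℝ ∞ N I) (hA : ContDiffOn ℝ ∞ A I)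
    (hB : ContDiffOn ℝ ∞ B I) (hC : ContDiffOn ℝ ∞ C I) (α β γ : ℝ) :
    IsKV (slab I) (bianchiIII N A B C) (xiComb α β γ) := by
  intro r hr μ ν
  have h := isCKV_affine hI (ψ := fun _ => 0) hN hA hB hC (c := 0) (α := α) (p := 0) (β := β)
    (q := α) (γ := γ) (by simp) (by simp) (by simp) (by simp) r hr μ ν
  have e : xiComb α β γ = fun r => ![0, α, 0 * r 2 + β, α * r 3 + γ] := by
    funext r i
    fin_cases i <;> simp [xiComb, xi1, xi2, xi3]
  rw [e, h]
  simp

/-- Logarithmic differentiation gives `(2/m) A'/A + k/m`. The values `k = mλ` and `k = m(λ-1)`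
produce the weights `ψ` and `ψ - 1` required of the scale factors. -/
theorem two_div_mul_deriv_mul_exp {A : ℝ → ℝ} {m t : ℝ} (hA : DifferentiableAt ℝ A t)
    (h0 : A t ≠ 0) (hm : m ≠ 0) (l k : ℝ) :
    2 / m * deriv (fun t => A t * Real.exp (k * t / 2)) t =
      (confFactor A m l t - (l - k / m)) * (A t * Real.exp (k * t / 2)) := by
  rw [(hasDerivAt_mul_exp_half hA k).deriv, confFactor]
  field_simp
  ring

/-- The line element `conformalBianchiIII` satisfies the conformal Killing equations of
`X₃ + αξ¹ + βξ² + γξ³`. -/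
theorem conformalBianchiIII_scaling {I : Set ℝ} (hI : IsOpen I) {A : ℝ → ℝ}
    (hA : ContDiffOn ℝ ∞ A I) (h0 : ∀ t ∈ I, A t ≠ 0) {m : ℝ} (hm : m ≠ 0) (l α : ℝ) :
    (∀ t ∈ I, 2 / m * deriv (fun t => A t * Real.exp (m * l * t / 2)) t =
        confFactor A m l t * (A t * Real.exp (m * l * t / 2))) ∧
      (∀ t ∈ I, 2 / m * deriv (fun t => A t * Real.exp (m * (l - 1) * t / 2)) t =
        (confFactor A m l t - 1) * (A t * Real.exp (m * (l - 1) * t / 2))) ∧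
      ∀ t ∈ I, 2 / m * deriv A t = (confFactor A m l t - (l + α - α)) * A t := by
  have dA : ∀ t ∈ I, DifferentiableAt ℝ A t := fun t ht =>
    (hA.differentiableOn (by simp)).differentiableAt (hI.mem_nhds ht)
  refine ⟨fun t ht => ?_, fun t ht => ?_, fun t ht => ?_⟩
  · rw [two_div_mul_deriv_mul_exp (dA t ht) (h0 t ht) hm l, mul_div_cancel_left₀ _ hm,
      sub_self, sub_zero]
  · rw [two_div_mul_deriv_mul_exp (dA t ht) (h0 t ht) hm l, mul_div_cancel_left₀ _ hm,
      sub_sub_cancel]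
  · have := h0 t ht
    rw [confFactor]
    field_simp
    ring

theorem isCKV_X3 {I : Set ℝ} (hI : IsOpen I) {A : ℝ → ℝ}
    (hA : ContDiffOn ℝ ∞ A I) (h0 : ∀ t ∈ I, A t ≠ 0) {m : ℝ} (hm : m ≠ 0) (l : ℝ) :
    IsCKV (slab I) (conformalBianchiIII A m l) (X3 m l) (fun p => confFactor A m l (p 0)) := by
  obtain ⟨k1, k2, k3⟩ := conformalBianchiIII_scaling hI hA h0 hm l 0
  have h := isCKV_affine hI (contDiffOn_mul_exp hA (m * l)) (contDiffOn_mul_exp hA (m * l))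
    (contDiffOn_mul_exp hA (m * (l - 1))) hA (β := 0) (γ := 0) k1 k1 k2 k3
  have e : X3 m l = fun r => ![2 / m, 0, 1 * r 2 + 0, (l + 0) * r 3 + 0] := by
    funext r
    simp [X3]
  rw [conformalBianchiIII_eq, e]
  exact h

theorem X3Field_eq (A : ℝ → ℝ) (m l α β γ : ℝ) :
    X3Field A m l α β γ = affineField (2 / m) α 1 β (l + α) γ (confFactor A m l) := by
  simp only [X3Field, affineField, PointField.mk.injEq, and_true]
  funext r i
  fin_cases i <;> simp [X3, xiComb, xi1, xi2, xi3]
  ring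

/-- Lie symmetries from the conformal Killing vectors `X₃ + αξ¹ + βξ² + γξ³`, for any integration
`zc` of the `z`-component with invariant `ζ`. -/
theorem isLieSymmetry_X3Field_iff {I : Set ℝ} (hI : IsOpen I) (hIc : I.OrdConnected)
    {A : ℝ → ℝ} (hA : ContDiffOn ℝ ∞ A I) (h0 : ∀ t ∈ I, A t ≠ 0) {m : ℝ} (hm : m ≠ 0) (l : ℝ)
    {V : Coord 4 → ℝ} (hV : ContDiffOn ℝ ∞ V (slab I)) (α β γ : ℝ) {zc ζ : ℝ → ℝ → ℝ}
    (hzc : ∀ t, ContDiff ℝ ∞ fun Z => zc Z t)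
    (hd : ∀ Z t, HasDerivAt (zc Z) (m / 2 * ((l + α) * zc Z t + γ)) t)
    (h1 : ∀ z t, zc (ζ z t) t = z) (h2 : ∀ Z t, ζ (zc Z t) t = Z) :
    IsLieSymmetry (slab I) (kleinGordon (conformalBianchiIII A m l) V) (X3Field A m l α β γ) ↔
      ∃ U : ℝ × ℝ × ℝ → ℝ, ContDiff ℝ ∞ U ∧
        ∀ t ∈ I, ∀ x y z : ℝ, V ![t, x, y, z] =
          1 / A t ^ 2 * Real.exp (-(m * l * t)) *
            U (x - α * m / 2 * t, (y + β) * Real.exp (-(m / 2 * t)), ζ z t)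
          + explicitTerm A m l t := by
  have hc := contDiffOn_confFactor hI hA h0 m l
  have hne : ∀ t ∈ I, ∀ k, A t * Real.exp k ≠ 0 := fun t ht k =>
    mul_ne_zero (h0 t ht) (Real.exp_pos k).ne'
  obtain ⟨k1, k2, k3⟩ := conformalBianchiIII_scaling hI hA h0 hm l α
  rw [conformalBianchiIII_eq, X3Field_eq, isLieSymmetry_affineField_iff hI
    (contDiffOn_mul_exp hA (m * l)) (contDiffOn_mul_exp hA (m * l))
    (contDiffOn_mul_exp hA (m * (l - 1))) hA hc
    (fun t ht => ⟨hne t ht _, hne t ht _, hne t ht _, h0 t ht⟩) k1 k1 k2 k3 hV]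
  -- `A² e^{mλt}` is an integrating factor: `2/m` times its logarithmic derivative is `2ψ`.
  let W : Coord 4 → ℝ := fun r => A (r 0) ^ 2 * Real.exp (m * l * r 0) *
    (V r - explicitTerm A m l (r 0))
  have hW : ContDiffOn ℝ ∞ W (slab I) := by
    have a1 : ContDiffOn ℝ ∞ (fun r : Coord 4 => A (r 0)) (slab I) :=
      hA.comp (f := fun r : Coord 4 => r 0) (by fun_prop) fun r hr => hr
    have a2 : ContDiffOn ℝ ∞ (fun r : Coord 4 => explicitTerm A m l (r 0)) (slab I) :=
      (contDiffOn_explicitTerm hI hA h0 m l).comp (f := fun r : Coord 4 => r 0) (by fun_prop)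
        fun r hr => hr
    exact ((a1.pow 2).mul (by fun_prop)).mul (hV.sub a2)
  have hpde : (∀ r ∈ slab I, fderiv ℝ V r ![2 / m, α, 1 * r 2 + β, (l + α) * r 3 + γ] +
      2 * confFactor A m l (r 0) * V r = ((A (r 0) * Real.exp (m * l * r 0 / 2)) ^ 2)⁻¹ *
        (deriv (deriv (confFactor A m l)) (r 0) +
          expansion (fun t => A t * Real.exp (m * l * t / 2))
            (fun t => A t * Real.exp (m * l * t / 2))
            (fun t => A t * Real.exp (m * (l - 1) * t / 2)) A (r 0) *
              deriv (confFactor A m l) (r 0))) ↔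
      ∀ r ∈ slab I, fderiv ℝ W r ![2 / m, α, r 2 + β, (l + α) * r 3 + γ] = 0 := by
    refine forall₂_congr fun r hr => ?_
    rw [rescaled_potential_transport hI hA h0 hm l hV hr (by simp),
      explicitTerm_transport hI hA h0 hm l hr, one_mul, mul_eq_zero, sub_eq_zero,
      or_iff_right (mul_ne_zero (pow_ne_zero 2 (h0 _ hr)) (Real.exp_pos _).ne')]
  rw [hpde]
  -- An empty `I` has no `t₀` for the cross-section, but then both sides hold trivially.
  rcases I.eq_empty_or_nonempty with hE | ⟨t₀, ht₀⟩
  · subst hE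
    exact ⟨fun _ => ⟨0, contDiff_const, by simp⟩, fun _ r hr => absurd hr (Set.notMem_empty _)⟩
  · rw [invariant_X3_iff hI hIc ht₀ hW hm α β (l + α) γ (hzc t₀) hd h1 h2]
    refine exists_congr fun U => and_congr_right fun _ => forall₂_congr fun t ht =>
      forall_congr' fun x => forall_congr' fun y => forall_congr' fun z => ?_
    have n0 := h0 t ht
    have n1 := (Real.exp_pos (m * l * t)).ne'
    simp only [W, Matrix.cons_val_zero, Real.exp_neg (m * l * t)]
    generalize U _ = u
    rw [← sub_eq_iff_eq_add]
    generalize V _ - explicitTerm A m l t = v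
    constructor
    · rintro rfl
      field_simp
    · rintro rfl
      field_simp

end KGSym

end

/-! ### Specialization to the stated generators. -/

theorem mainTheorem2 (I : Set ℝ) (hIo : IsOpen I) (hIc : I.OrdConnected) :
    -- general Bianchi III spacetimes
    (∀ N A B C : ℝ → ℝ,
      ContDiffOn ℝ ∞ N I → ContDiffOn ℝ ∞ A I → ContDiffOn ℝ ∞ B I → ContDiffOn ℝ ∞ C I →
      (∀ t ∈ I, N t ≠ 0 ∧ A t ≠ 0 ∧ B t ≠ 0 ∧ C t ≠ 0) →
      (KGSym.IsKV (KGSym.slab I) (KGSym.bianchiIII N A B C) KGSym.xi1 ∧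
        KGSym.IsKV (KGSym.slab I) (KGSym.bianchiIII N A B C) KGSym.xi2 ∧
        KGSym.IsKV (KGSym.slab I) (KGSym.bianchiIII N A B C) KGSym.xi3) ∧
      ∀ V : KGSym.Coord 4 → ℝ, ContDiffOn ℝ ∞ V (KGSym.slab I) →
        -- (i)
        (KGSym.IsLieSymmetry (KGSym.slab I) (KGSym.kleinGordon (KGSym.bianchiIII N A B C) V)
            (KGSym.horizontal KGSym.xi1) ↔
          ∃ U : ℝ × ℝ × ℝ → ℝ, ContDiffOn ℝ ∞ U (I ×ˢ Set.univ) ∧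
            ∀ t ∈ I, ∀ x y z : ℝ, V ![t, x, y, z] = U (t, y, z * Real.exp (-x))) ∧
        -- (ii)
        (KGSym.IsLieSymmetry (KGSym.slab I) (KGSym.kleinGordon (KGSym.bianchiIII N A B C) V)
            (KGSym.horizontal KGSym.xi2) ↔
          ∃ U : ℝ × ℝ × ℝ → ℝ, ContDiffOn ℝ ∞ U (I ×ˢ Set.univ) ∧
            ∀ t ∈ I, ∀ x y z : ℝ, V ![t, x, y, z] = U (t, x, z)) ∧
        -- (iii)
        (KGSym.IsLieSymmetry (KGSym.slab I) (KGSym.kleinGordon (KGSym.bianchiIII N A B C) V)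
            (KGSym.horizontal KGSym.xi3) ↔
          ∃ U : ℝ × ℝ × ℝ → ℝ, ContDiffOn ℝ ∞ U (I ×ˢ Set.univ) ∧
            ∀ t ∈ I, ∀ x y z : ℝ, V ![t, x, y, z] = U (t, x, y)) ∧
        -- (iv)
        (∀ α β γ : ℝ, α ≠ 0 →
          (KGSym.IsLieSymmetry (KGSym.slab I) (KGSym.kleinGordon (KGSym.bianchiIII N A B C) V)
              (KGSym.horizontal (KGSym.xiComb α β γ)) ↔
            ∃ U : ℝ × ℝ × ℝ → ℝ, ContDiffOn ℝ ∞ U (I ×ˢ Set.univ) ∧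
              ∀ t ∈ I, ∀ x y z : ℝ, V ![t, x, y, z] =
                U (t, y - β / α * x, (z + γ / α) * Real.exp (-x)))) ∧
        -- (iv) for combinations of the two translations only
        (∀ β γ : ℝ, (β ≠ 0 ∨ γ ≠ 0) →
          (KGSym.IsLieSymmetry (KGSym.slab I) (KGSym.kleinGordon (KGSym.bianchiIII N A B C) V)
              (KGSym.horizontal (KGSym.xiComb 0 β γ)) ↔
            ∃ U : ℝ × ℝ × ℝ → ℝ, ContDiffOn ℝ ∞ U (I ×ˢ Set.univ) ∧
              ∀ t ∈ I, ∀ x y z : ℝ, V ![t, x, y, z] = U (t, x, β * z - γ * y)))) ∧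
    -- the line element with the additional conformal Killing vector
    (∀ (A : ℝ → ℝ) (m l : ℝ), m ≠ 0 → ContDiffOn ℝ ∞ A I → (∀ t ∈ I, A t ≠ 0) →
      KGSym.IsCKV (KGSym.slab I) (KGSym.conformalBianchiIII A m l) (KGSym.X3 m l)
        (fun p => KGSym.confFactor A m l (p 0)) ∧
      ∀ V : KGSym.Coord 4 → ℝ, ContDiffOn ℝ ∞ V (KGSym.slab I) →
        -- (v)
        (KGSym.IsLieSymmetry (KGSym.slab I)
            (KGSym.kleinGordon (KGSym.conformalBianchiIII A m l) V)
            (KGSym.X3Field A m l 0 0 0) ↔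
          ∃ U : ℝ × ℝ × ℝ → ℝ, ContDiff ℝ ∞ U ∧
            ∀ t ∈ I, ∀ x y z : ℝ, V ![t, x, y, z] =
              1 / A t ^ 2 * Real.exp (-(m * l * t)) *
                U (x, y * Real.exp (-(m / 2 * t)), z * Real.exp (-(m * l / 2 * t)))
              + KGSym.explicitTerm A m l t) ∧
        -- (vi)
        (∀ α β γ : ℝ, l + α ≠ 0 →
          (KGSym.IsLieSymmetry (KGSym.slab I)
              (KGSym.kleinGordon (KGSym.conformalBianchiIII A m l) V)
              (KGSym.X3Field A m l α β γ) ↔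
            ∃ U : ℝ × ℝ × ℝ → ℝ, ContDiff ℝ ∞ U ∧
              ∀ t ∈ I, ∀ x y z : ℝ, V ![t, x, y, z] =
                1 / A t ^ 2 * Real.exp (-(m * l * t)) *
                  U (x - α * m / 2 * t, (y + β) * Real.exp (-(m / 2 * t)),
                    (z + γ / (l + α)) * Real.exp (-(m * (l + α) / 2 * t)))
                + KGSym.explicitTerm A m l t)) ∧
        -- (vi) in the degenerate case
        (∀ α β γ : ℝ, l + α = 0 →
          (KGSym.IsLieSymmetry (KGSym.slab I)
              (KGSym.kleinGordon (KGSym.conformalBianchiIII A m l) V)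
              (KGSym.X3Field A m l α β γ) ↔
            ∃ U : ℝ × ℝ × ℝ → ℝ, ContDiff ℝ ∞ U ∧
              ∀ t ∈ I, ∀ x y z : ℝ, V ![t, x, y, z] =
                1 / A t ^ 2 * Real.exp (-(m * l * t)) *
                  U (x - α * m / 2 * t, (y + β) * Real.exp (-(m / 2 * t)), z - γ * m / 2 * t)
                + KGSym.explicitTerm A m l t))) := by
  refine ⟨fun N A B C hN hA hB hC h0 => ⟨?_, fun V hV => ?_⟩, fun A m l hm hA h0 =>
    ⟨KGSym.isCKV_X3 hIo hA h0 hm l, fun V hV => ?_⟩⟩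
  · rw [KGSym.xi1_eq, KGSym.xi2_eq, KGSym.xi3_eq]
    exact ⟨KGSym.isKV_xiComb hIo hN hA hB hC _ _ _, KGSym.isKV_xiComb hIo hN hA hB hC _ _ _,
      KGSym.isKV_xiComb hIo hN hA hB hC _ _ _⟩
  · have h := KGSym.isLieSymmetry_xiComb_iff hIo hN hA hB hC h0 hV
    have h4 := fun (α β γ : ℝ) (hα : α ≠ 0) =>
      (h α β γ).trans (KGSym.invariant_homothetic_iff hIo hV hα β γ)
    have h5 := fun (β γ : ℝ) (hβγ : β ≠ 0 ∨ γ ≠ 0) =>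
      (h 0 β γ).trans (by simpa using KGSym.invariant_translation_iff hIo hV hβγ)
    refine ⟨?_, ?_, ?_, h4, h5⟩
    · rw [KGSym.xi1_eq]
      simpa using h4 1 0 0 one_ne_zero
    · rw [KGSym.xi2_eq]
      simpa using h5 1 0 (Or.inl one_ne_zero)
    -- For `β = 0`, `γ = 1` the general invariant is `-y`, so `U` is reflected in its last argument.
    · rw [KGSym.xi3_eq, h5 0 1 (Or.inr one_ne_zero)]
      have hmap : Set.MapsTo (fun a : ℝ × ℝ × ℝ => (a.1, a.2.1, -a.2.2)) (I ×ˢ Set.univ)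
        (I ×ˢ Set.univ) := fun a ha => ⟨ha.1, trivial⟩
      constructor
      · rintro ⟨U, hU, hVU⟩
        refine ⟨fun a => U (a.1, a.2.1, -a.2.2), hU.comp (by fun_prop) hmap, fun t ht x y z => ?_⟩
        simp [hVU t ht x y z]
      · rintro ⟨U, hU, hVU⟩
        refine ⟨fun a => U (a.1, a.2.1, -a.2.2), hU.comp (by fun_prop) hmap, fun t ht x y z => ?_⟩
        simp [hVU t ht x y z]
  -- The `z`-component solves `dz/dt = (m/2)((λ+α) z + γ)`: exponential about the fixed point
  -- `-γ/(λ+α)`, or linear in `t` when `λ + α = 0`.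
  · have hgen : ∀ α β γ : ℝ, l + α ≠ 0 → _ := fun α β γ hl =>
      KGSym.isLieSymmetry_X3Field_iff hIo hIc hA h0 hm l hV α β γ
        (zc := fun Z t => Z * Real.exp (m * (l + α) / 2 * t) - γ / (l + α))
        (ζ := fun z t => (z + γ / (l + α)) * Real.exp (-(m * (l + α) / 2 * t)))
        (fun t => by fun_prop)
        (fun Z t => by
          have hE : HasDerivAt (fun s : ℝ => Real.exp (m * (l + α) / 2 * s))
              (Real.exp (m * (l + α) / 2 * t) * (m * (l + α) / 2)) t := by
            simpa using ((hasDerivAt_id t).const_mul (m * (l + α) / 2)).exp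
          refine ((hE.const_mul Z).sub_const _).congr_deriv ?_
          field_simp
          ring)
        (fun z t => by simp [mul_assoc, ← Real.exp_add])
        (fun Z t => by simp [mul_assoc, ← Real.exp_add])
    have hdeg : ∀ α β γ : ℝ, l + α = 0 → _ := fun α β γ hl =>
      KGSym.isLieSymmetry_X3Field_iff hIo hIc hA h0 hm l hV α β γ
        (zc := fun Z t => Z + γ * m / 2 * t) (ζ := fun z t => z - γ * m / 2 * t)
        (fun t => by fun_prop)
        (fun Z t => by
          refine (((hasDerivAt_id t).const_mul (γ * m / 2)).const_add Z).congr_deriv ?_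
          rw [hl]
          ring)
        (fun z t => by ring) (fun Z t => by ring)
    refine ⟨?_, hgen, hdeg⟩
    -- For `α = β = γ = 0` the degenerate case is `λ = 0`, where `z e^{-mλt/2}` reduces to `z` and
    -- one formula serves both cases.
    by_cases hl : l = 0
    · have := hdeg 0 0 0 (by simpa using hl)
      simpa [hl] using this
    · have := hgen 0 0 0 (by simpa using hl)
      simpa using this
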